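/- **Setting.** Let $A$ be a finite-dimensional real alternative algebra (not necessarily associative) with unit $1\ne 0$ and a $^*$-involution $x\mapsto x^c$ (real linear, $(x^c)^c=x$, $(xy)^c=y^cx^c$, $r^c=r$ for $r\in\mathbb R=\mathbb R1$). Put $$\mathbb S_A=\{x: x+x^c=0,\ xx^c=1\},\qquad Q_A=\mathbb R\cup\{x: t=x+x^c\in\mathbb R,\ n=xx^c\in\mathbb R,\ t^2<4n\},$$ assume $\mathbb S_A\neq\emptyset$, and let $\|\cdot\|_A$ be a norm on $A$ with $\|x\|_A^2=xx^c$ for all $x\in Q_A$. For $E\subseteq\mathbb C$ let $\Omega_E=\{\alpha+\beta J\in Q_A:\alpha+i\beta\in E,\ J\in\mathbb S_A\}$; sets of this form are called *circular*. A *stem function* on a nonempty conjugation-invariant $D\subseteq\mathbb C$ is a map $F=F_1+\imath F_2:D\to A\otimes_{\mathbb R}\mathbb C$ with $F_1(\bar z)=F_1(z)$, $F_2(\bar z)=-F_2(z)$. A function $f:\Omega_D\to A$, with $\Omega_D$ open in $Q_A$, is *slice regular*, $f\in\mathcal{SR}(\Omega_D)$, if $f(\alpha+\beta J)=F_1(\alpha+i\beta)+JF_2(\alpha+i\beta)$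 for all $\alpha+i\beta\in D$, $J\in\mathbb S_A$, where $F$ is a $\mathscr C^1$ stem function with $\frac{\partial F}{\partial\alpha}+\imath\frac{\partial F}{\partial\beta}=0$ on $D$. Let $f\in\mathcal{SR}(\Omega)$ and $y\in\mathbb R$. The point $y$ is a *singularity* for $f$ if $\{x\in Q_A:0<\|x-y\|_A<R\}\subseteq\Omega$ for some $R>0$; then for some such $R$ there is an expansion $f(x)=\sum_{n\in\mathbb Z}(x-y)^na_n$ on this set (for real $y$ the slice product $(x-y)^{\bullet n}\cdot a_n$ is $(x-y)^na_n$). The *order* $\mathrm{ord}_f(y)\in\mathbb N\cup\{+\infty\}$ is the least $m\in\mathbb N$ with $a_{-k}=0$ for all $k>m$, and $+\infty$ if there is none. The singularity $y$ is a *pole* if such an $m$ exists and *essential* otherwise; it is *removable* if $f$ extends to a slice regular function on a circular open subset of $Q_A$ containing $y$. **Theorem.** Let $\widetilde\Omega$ be a circular open subset of $Q_A$, let $y\in\widetilde\Omega\cap\mathbb R$, set $\Omega=\widetilde\Omega\setminus\{y\}$, and let $f:\Omega\to A$ be slice regular. Then $y$ is a singularity for $f$, the sequence $(a_n)_{n\in\mathbb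 Z}$ above exists and is unique, and one of the following holds. 1. The point $y$ is a removable singularity for $f$. This is equivalent to each of: - (1a) $\mathrm{ord}_f(y)=0$; - (1b) there is a neighborhood $U$ of $y$ in $\widetilde\Omega$ such that $\|f\|_A$ is bounded in $U\setminus\{y\}$. 2. The point $y$ is a non-removable pole for $f$. This is equivalent to each of: - (2a) $\mathrm{ord}_f(y)$ is finite and positive; - (2b) there is $k\in\mathbb N\setminus\{0\}$ such that $x\mapsto(x-y)^kf(x)$ on $\Omega$ extends to some $g\in\mathcal{SR}(\widetilde\Omega)$ with $g(y)\neq0$. Moreover, for every $k$ and $g$ as in (2b), $k=\mathrm{ord}_f(y)$ and $\lim_{\Omega\ni x\to y}\|f(x)\|_A=+\infty$. 3. The point $y$ is an essential singularity for $f$. This is equivalent to each of: - (3a) $\mathrm{ord}_f(y)=+\infty$; - (3b) for all neighborhoods $U$ of $y$ in $\widetilde\Omega$ and all $k\in\mathbb N$, $\ \sup_{x\in U\setminus\{y\}}\|(x-y)^kf(x)\|_A=+\infty$. -/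

import Mathlib

open Filter Topology

/-- A (unital, not necessarily associative) alternative ring equipped with a norm inducing its
topology. No compatibility between the norm and the product is required here. -/
class NormedAlternativeRing (A : Type*) extends Norm A, NonAssocRing A, MetricSpace A where
  dist_eq : ∀ x y : A, dist x y = norm (-x + y)
  left_alternative : ∀ x y : A, associator x x y = 0
  right_alternative : ∀ x y : A, associator y x x = 0

instance NormedAlternativeRing.toNormedAddCommGroup {A : Type*} [h : NormedAlternativeRing A] :
    NormedAddCommGroup A :=
  { h with dist_eq := h.dist_eq }

namespace SliceRegular

section Basic

variable {A : Type*} [NormedAlternativeRing A] [NormedSpace ℝ A]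

/-- `x ^ k` for a natural exponent (the product of `A` need not be associative, but it is
power-associative, so the bracketing is irrelevant). -/
def pow (x : A) : ℕ → A
  | 0 => 1
  | k + 1 => x * pow x k

/-- The element `α + β J` of `A`, where `z = α + β i`. -/
def sliceEmb (J : A) (z : ℂ) : A := z.re • (1 : A) + z.im • J

variable [StarRing A]

variable (A) in
/-- The set `𝕊_A` of the `x` with trace `x + xᶜ = 0` and norm `x xᶜ = 1`. -/
def imagUnits : Set A := {x | x + star x = 0 ∧ x * star x = 1}

variable (A) in
/-- The quadratic cone `Q_A`. -/
def quadraticCone : Set A :=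
  Set.range (fun r : ℝ => r • (1 : A)) ∪
    {x | ∃ t n : ℝ, x + star x = t • (1 : A) ∧ x * star x = n • (1 : A) ∧ t ^ 2 < 4 * n}

/-- The circularization `Ω_E` of a set `E` of complex numbers. -/
def circularization (A : Type*) [NormedAlternativeRing A] [NormedSpace ℝ A] [StarRing A]
    (E : Set ℂ) : Set A :=
  {x | x ∈ quadraticCone A ∧ ∃ z ∈ E, ∃ J ∈ imagUnits A, x = sliceEmb J z}

/-- Circular subsets of the quadratic cone. -/
def IsCircular (Ω : Set A) : Prop := ∃ E : Set ℂ, Ω = circularization A E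

/-- `Ω` is a subset of the quadratic cone, open in the relative topology. -/
def IsOpenInCone (Ω : Set A) : Prop := ∃ U : Set A, IsOpen U ∧ Ω = U ∩ quadraticCone A

/-! The complexified algebra `A_ℂ = A + ı A` is represented by pairs: `(p₁, p₂)` is `p₁ + ı p₂`. -/

/-- The product of the complexified algebra. -/
def cplxMul (p q : A × A) : A × A := (p.1 * q.1 - p.2 * q.2, p.1 * q.2 + p.2 * q.1)

/-- The inclusion of `ℂ ≃ ℝ + ı ℝ` in the complexified algebra. -/
def ofComplex (c : ℂ) : A × A := (c.re • (1 : A), c.im • (1 : A))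

/-- The value `p₁ + J p₂`. -/
def evalAt (J : A) (p : A × A) : A := p.1 + J * p.2

/-- `F : D → A_ℂ` is a stem function on `D`. -/
def IsStemOn (D : Set ℂ) (F : ℂ → A × A) : Prop :=
  ∀ z ∈ D, (F (star z)).1 = (F z).1 ∧ (F (star z)).2 = -(F z).2

/-- The slice function `f` on `Ω_D` is induced by `F`, i.e. `f (α + β J) = F₁ z + J F₂ z`. -/
def IsInducedOn (D : Set ℂ) (F : ℂ → A × A) (f : A → A) : Prop :=
  ∀ z ∈ D, ∀ J ∈ imagUnits A, f (sliceEmb J z) = evalAt J (F z)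

/-- The derivative `∂F/∂z̄ = (∂F/∂α + ı ∂F/∂β) / 2`. -/
noncomputable def dbar (F : ℂ → A × A) (z : ℂ) : A × A :=
  (1 / 2 : ℝ) •
    (fderiv ℝ F z 1 + cplxMul (0, 1) (fderiv ℝ F z Complex.I))

/-- `f` (restricted to `Ω`) is a slice regular function on `Ω = Ω_D`, with `Ω` open in the
quadratic cone: it is induced by a stem function of class `C¹` with vanishing `∂F/∂z̄`.
Values of `f` outside `Ω` are irrelevant. -/
def SliceRegularOn (f : A → A) (Ω : Set A) : Prop :=
  IsOpenInCone Ω ∧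
  ∃ D : Set ℂ, D.Nonempty ∧ (∀ z ∈ D, star z ∈ D) ∧ Ω = circularization A D ∧
    ∃ F : ℂ → A × A, IsStemOn D F ∧ IsInducedOn D F f ∧
      ContDiffOn ℝ 1 F D ∧ ∀ z ∈ D, dbar F z = 0

/-- For real `y`, the set `Σ(y, 0, R)` is the punctured ball of the quadratic cone. -/
def puncturedBall (y : ℝ) (R : ℝ) : Set A :=
  {x | x ∈ quadraticCone A ∧ 0 < ‖x - y • (1 : A)‖ ∧ ‖x - y • (1 : A)‖ < R}

/-- The value at `x = α + β J` of `(x - y)^{• n} · a`, where `•` and `·` denote the slice product.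
For real `y`, the slice function `(x - y)^{• n}` is induced by `(z - y) ^ n ∈ ℂ ≃ ℝ + ı ℝ`, and
the slice product corresponds to the product of stem functions in `A_ℂ`. -/
noncomputable def laurentTerm (y : ℝ) (n : ℤ) (a : A) (J : A) (z : ℂ) : A :=
  evalAt J (cplxMul (ofComplex ((z - (y : ℂ)) ^ n)) (a, 0))

/-- The real point `y` is a singularity for functions that are slice regular on `Ω`. -/
def IsSingularity (Ω : Set A) (y : ℝ) : Prop :=
  ∃ R : ℝ, 0 < R ∧ puncturedBall y R ⊆ Ω

/-- `f(x) = ∑_{n ∈ ℤ} (x - y)^{• n} · a_n` on some `Σ(y, 0, R) ⊆ Ω`, with `R > 0`. -/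
def HasLaurentExpansion (Ω : Set A) (f : A → A) (y : ℝ) (a : ℤ → A) : Prop :=
  ∃ R : ℝ, 0 < R ∧ (puncturedBall y R : Set A) ⊆ Ω ∧
    ∀ z : ℂ, ∀ J ∈ imagUnits A, sliceEmb J z ∈ (puncturedBall y R : Set A) →
      HasSum (fun n : ℤ => laurentTerm y n (a n) J z) (f (sliceEmb J z))

open Classical in
/-- The coefficients of the Laurent expansion of `f` at `y` (meaningful where there is one). -/
noncomputable def laurentCoeff (Ω : Set A) (f : A → A) (y : ℝ) : ℤ → A :=
  if h : ∃ a, HasLaurentExpansion Ω f y a then h.choose else 0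

/-- `y` is a pole for `f`. -/
def IsPole (Ω : Set A) (f : A → A) (y : ℝ) : Prop :=
  IsSingularity Ω y ∧ ∃ m : ℕ, ∀ k : ℕ, m < k → laurentCoeff Ω f y (-(k : ℤ)) = 0

/-- `ord_f(y)`: the least `m : ℕ` with `a_{-k} = 0` for all `k > m`; `+∞` if there is none. -/
noncomputable def order (Ω : Set A) (f : A → A) (y : ℝ) : ℕ∞ :=
  sInf ((fun m : ℕ => (m : ℕ∞)) ''
    {m : ℕ | ∀ k : ℕ, m < k → laurentCoeff Ω f y (-(k : ℤ)) = 0})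

/-- `y` is an essential singularity for `f`. -/
def IsEssentialSingularity (Ω : Set A) (f : A → A) (y : ℝ) : Prop :=
  IsSingularity Ω y ∧ ¬ IsPole Ω f y

/-- `y` is a removable singularity for `f : Ω → A`: `f` extends to a slice regular function on a
circular open set containing `y`. -/
def IsRemovableSingularity (Ω : Set A) (f : A → A) (y : ℝ) : Prop :=
  IsSingularity Ω y ∧ ∃ (Ω' : Set A) (g : A → A),
    Ω ⊆ Ω' ∧ y • (1 : A) ∈ Ω' ∧ SliceRegularOn g Ω' ∧ Set.EqOn g f Ω

end Basic

end SliceRegular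

/-!
In real coordinates on `A`, a stem function is a map `Φ` into `ℂⁿ` with `Φ (star z) = star (Φ z)`,
and the condition `∂F/∂z̄ = 0` says that `Φ` is holomorphic. The representation formula recovers `Φ`
from the values of `f` on the two half-slices of a single `J ∈ 𝕊_A`, so expansions, bounds and
limits pass between `f` near the real point `y` and `Φ` near `y`. The Laurent expansion of `f` is
thus that of `Φ`, whose coefficients are real because `Φ` commutes with conjugation, and Riemann's
removable singularity theorem for `Φ` gives the removable case. Since `y` is real, multiplying `f`
by `(x - y) ^ k` multiplies `Φ` by `(z - y) ^ k` and shifts the coefficients by `k`, which reduces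
poles and essential singularities to the removable case.
-/

namespace SliceRegular

section Laurent

open Metric Complex Set

variable {E : Type*} [NormedAddCommGroup E] [NormedSpace ℂ E] {g h : ℂ → E} {c z : ℂ}
  {R r s ρ : ℝ}

/-- The `n`-th Laurent coefficient of `g` at `c`, as a contour integral over the circle of
radius `r`. -/
noncomputable def circleCoeff (g : ℂ → E) (c : ℂ) (r : ℝ) (n : ℤ) : E :=
  (2 * Real.pi * I : ℂ)⁻¹ • ∮ z in C(c, r), (z - c) ^ (-n - 1) • g z

theorem sphere_subset_ball_diff_center (hr : r ∈ Ioo 0 R) : sphere c r ⊆ ball c R \ {c} :=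
  fun _ hz => ⟨closedBall_subset_ball hr.2 (sphere_subset_closedBall hz),
    ne_of_mem_sphere hz hr.1.ne'⟩

theorem differentiableOn_sub_zpow (n : ℤ) : DifferentiableOn ℂ (fun z => (z - c) ^ n) {c}ᶜ :=
  fun _ hz => ((differentiableAt_id.sub_const c).zpow
    (Or.inl (sub_ne_zero.2 hz))).differentiableWithinAt

theorem continuousOn_sphere_sub_zpow (hr : 0 < r) (n : ℤ) :
    ContinuousOn (fun z => (z - c) ^ n) (sphere c r) :=
  (differentiableOn_sub_zpow n).continuousOn.mono fun _ hz => ne_of_mem_sphere hz hr.ne'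

theorem circleIntegral_eq_of_differentiableOn (hg : DifferentiableOn ℂ g (ball c R \ {c}))
    (hr : r ∈ Ioo 0 R) (hs : s ∈ Ioo 0 R) : (∮ z in C(c, r), g z) = ∮ z in C(c, s), g z := by
  wlog hrs : r ≤ s generalizing r s
  · exact (this hs hr (le_of_not_ge hrs)).symm
  have hsub : closedBall c s \ ball c r ⊆ ball c R \ {c} := fun z hz =>
    ⟨hz.1.trans_lt hs.2, fun hzc => hz.2 (mem_singleton_iff.1 hzc ▸ mem_ball_self hr.1)⟩
  refine (circleIntegral_eq_of_differentiable_on_annulus_off_countable hr.1 hrs countable_empty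
    (hg.continuousOn.mono hsub) fun z hz => ?_).symm
  exact hg.differentiableAt ((isOpen_ball.sdiff isClosed_singleton).mem_nhds
    (hsub ⟨ball_subset_closedBall hz.1.1, fun hzr => hz.1.2 (ball_subset_closedBall hzr)⟩))

theorem circleCoeff_eq_of_differentiableOn (hg : DifferentiableOn ℂ g (ball c R \ {c}))
    (hr : r ∈ Ioo 0 R) (hs : s ∈ Ioo 0 R) (n : ℤ) : circleCoeff g c r n = circleCoeff g c s n :=
  congrArg _ (circleIntegral_eq_of_differentiableOn
    (((differentiableOn_sub_zpow _).mono fun _ hz => hz.2).smul hg) hr hs)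

theorem circleCoeff_congr (hr : 0 < r) (hgh : EqOn g h (sphere c r)) (n : ℤ) :
    circleCoeff g c r n = circleCoeff h c r n :=
  congrArg _ (circleIntegral.integral_congr hr.le fun z hz => by simp only [hgh hz])

theorem circleCoeff_zpow_smul (hr : 0 < r) (k n : ℤ) :
    circleCoeff (fun z => (z - c) ^ k • g z) c r n = circleCoeff g c r (n - k) := by
  refine congrArg _ (circleIntegral.integral_congr hr.le fun z hz => ?_)
  have hzc : z - c ≠ 0 := sub_ne_zero.2 (ne_of_mem_sphere hz hr.ne')
  simp only [smul_smul, ← zpow_add₀ hzc]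
  congr 2
  ring

theorem hasSum_circleIntegral_of_dominated {ι : Type*} [Countable ι] {F : ι → ℂ → E}
    (hr : 0 ≤ r) {u : ι → ℝ} (hF : ∀ i, ContinuousOn (F i) (sphere c r))
    (hFu : ∀ i, ∀ z ∈ sphere c r, ‖F i z‖ ≤ u i) (hu : Summable u)
    (hsum : ∀ z ∈ sphere c r, HasSum (fun i => F i z) (g z)) :
    HasSum (fun i => ∮ z in C(c, r), F i z) (∮ z in C(c, r), g z) := by
  refine intervalIntegral.hasSum_integral_of_dominated_convergence (fun i _ => r * u i)
    (fun i => ((hF i).circleIntegrable hr).out.def'.aestronglyMeasurable)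
    (fun i => .of_forall fun θ _ => ?_) (.of_forall fun θ _ => hu.mul_left r) (by simp)
    (.of_forall fun θ _ => (hsum _ (circleMap_mem_sphere _ hr _)).const_smul _)
  simp only [norm_smul, deriv_circleMap, norm_mul, norm_circleMap_zero, norm_I, mul_one,
    abs_of_nonneg hr]
  exact mul_le_mul_of_nonneg_left (hFu i _ (circleMap_mem_sphere _ hr _)) hr

theorem circleCoeff_eq_zero_of_neg (hg : DifferentiableOn ℂ g (ball c R)) (hρ : ρ ∈ Ioo 0 R)
    {n : ℤ} (hn : n < 0) : circleCoeff g c ρ n = 0 := by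
  obtain ⟨m, hm⟩ := Int.eq_ofNat_of_zero_le (show 0 ≤ -n - 1 by omega)
  have hd : DifferentiableOn ℂ (fun z => (z - c) ^ m • g z) (ball c R) :=
    ((differentiableOn_id.sub_const c).pow m).smul hg
  simp only [circleCoeff, hm, zpow_natCast, (hd.diffContOnCl_ball
    (closedBall_subset_ball hρ.2)).circleIntegral_eq_zero hρ.1.le, smul_zero]

theorem hasSum_circleCoeff_nat (hg : ContinuousOn g (sphere c s)) (hzs : dist z c < s) :
    HasSum (fun n : ℕ => (z - c) ^ (n : ℤ) • circleCoeff g c s n)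
      ((2 * Real.pi * I : ℂ)⁻¹ • ∮ w in C(c, s), (w - z)⁻¹ • g w) := by
  have hs : 0 < s := dist_nonneg.trans_lt hzs
  have hsum := hasSum_cauchyPowerSeries_integral (hg.circleIntegrable hs.le)
    (dist_eq_norm z c ▸ hzs)
  rw [add_sub_cancel] at hsum
  convert! hsum using 2 with n
  rw [cauchyPowerSeries, ContinuousMultilinearMap.mkPiRing_apply, circleCoeff, Fin.prod_const,
    zpow_natCast]
  congr 2
  refine circleIntegral.integral_congr hs.le fun w hw => ?_
  have hwc : w - c ≠ 0 := sub_ne_zero.2 (ne_of_mem_sphere hw hs.ne')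
  simp only [smul_smul, sub_eq_add_neg (-(n : ℤ)), zpow_add₀ hwc, zpow_neg, zpow_natCast,
    zpow_one, inv_pow]

theorem hasSum_inv_sub_of_norm_lt {w z : ℂ} (h : ‖w‖ < ‖z‖) :
    HasSum (fun n : ℕ => w ^ n * z ^ (-((n : ℤ) + 1))) (z - w)⁻¹ := by
  have hz : z ≠ 0 := norm_pos_iff.1 ((norm_nonneg w).trans_lt h)
  have hwz : ‖w / z‖ < 1 := by rwa [norm_div, div_lt_one (norm_pos_iff.2 hz)]
  convert! (hasSum_geometric_of_norm_lt_one hwz).mul_right z⁻¹ using 1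
  · funext n
    rw [zpow_neg, zpow_add_one₀ hz, zpow_natCast, div_pow]
    field_simp
  · rw [← mul_inv, sub_mul, one_mul, div_mul_cancel₀ _ hz]

theorem hasSum_circleCoeff_neg (hr : 0 < r) (hg : ContinuousOn g (sphere c r))
    (hrz : r < dist z c) :
    HasSum (fun n : ℕ => (z - c) ^ (-((n : ℤ) + 1)) • circleCoeff g c r (-((n : ℤ) + 1)))
      (-((2 * Real.pi * I : ℂ)⁻¹ • ∮ w in C(c, r), (w - z)⁻¹ • g w)) := by
  rw [dist_eq_norm] at hrz
  have hz : 0 < ‖z - c‖ := hr.trans hrz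
  obtain ⟨M, hM⟩ := (isCompact_sphere c r).exists_bound_of_continuousOn hg
  have hsum := hasSum_circleIntegral_of_dominated (c := c) hr.le
    (F := fun (n : ℕ) w => ((w - c) ^ n * (z - c) ^ (-((n : ℤ) + 1))) • g w)
    (g := fun w => (z - w)⁻¹ • g w) (u := fun n => (r / ‖z - c‖) ^ n * (‖z - c‖⁻¹ * M))
    (fun n => ContinuousOn.smul (by fun_prop) hg)
    (fun n w hw => by
      rw [norm_smul, norm_mul, norm_pow, norm_zpow, mem_sphere_iff_norm.1 hw]
      refine (mul_le_mul_of_nonneg_left (hM w hw) (by positivity)).trans_eq ?_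
      rw [zpow_neg, zpow_add_one₀ hz.ne', zpow_natCast, div_pow]
      field_simp)
    ((summable_geometric_of_lt_one (by positivity) ((div_lt_one hz).2 hrz)).mul_right _)
    (fun w hw => by
      have hwz : ‖w - c‖ < ‖z - c‖ := by rwa [mem_sphere_iff_norm.1 hw]
      simpa only [sub_sub_sub_cancel_right] using (hasSum_inv_sub_of_norm_lt hwz).smul_const (g w))
  convert! hsum.const_smul (2 * Real.pi * I : ℂ)⁻¹ using 1
  · funext n
    rw [circleCoeff, smul_comm, ← circleIntegral.integral_smul, neg_neg, add_sub_cancel_right]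
    simp only [smul_smul, zpow_natCast, mul_comm]
  · rw [← smul_neg, ← neg_one_smul ℂ (∮ w in C(c, r), _), ← circleIntegral.integral_smul]
    simp only [neg_one_smul, ← neg_smul, ← inv_neg, neg_sub]

theorem hasSum_circleIntegral_zpow_smul [FiniteDimensional ℂ E] (hr : 0 < r) {a : ℤ → E}
    (hsum : ∀ z ∈ sphere c r, HasSum (fun n : ℤ => (z - c) ^ n • a n) (g z)) (m : ℤ) :
    HasSum (fun n : ℤ => ∮ z in C(c, r), (z - c) ^ m • (z - c) ^ n • a n)
      (∮ z in C(c, r), (z - c) ^ m • g z) := by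
  have hu : Summable fun n : ℤ => r ^ n * ‖a n‖ := by
    have hmem : c + r ∈ sphere c r := by simp [abs_of_pos hr]
    simpa only [norm_smul, norm_zpow, mem_sphere_iff_norm.1 hmem] using (hsum _ hmem).summable.norm
  exact hasSum_circleIntegral_of_dominated hr.le (u := fun n => r ^ m * (r ^ n * ‖a n‖))
    (fun n => (continuousOn_sphere_sub_zpow hr m).smul
      ((continuousOn_sphere_sub_zpow hr n).smul continuousOn_const))
    (fun n z hz => by simp only [norm_smul, norm_zpow, mem_sphere_iff_norm.1 hz, le_rfl])
    (hu.mul_left _) (fun z hz => (hsum z hz).const_smul _)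

variable [CompleteSpace E]

theorem circleIntegral_zpow_smul_zpow_smul (hr : 0 < r) (m n : ℤ) (a : E) :
    (∮ z in C(c, r), (z - c) ^ (-m - 1) • (z - c) ^ n • a) =
      if n = m then (2 * Real.pi * I : ℂ) • a else 0 := by
  have hmul : (∮ z in C(c, r), (z - c) ^ (-m - 1) • (z - c) ^ n • a) =
      (∮ z in C(c, r), (z - c) ^ (n - m - 1)) • a := by
    rw [← circleIntegral.integral_smul_const]
    refine circleIntegral.integral_congr hr.le fun z hz => ?_
    simp only [smul_smul, ← zpow_add₀ (sub_ne_zero.2 (ne_of_mem_sphere hz hr.ne'))]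
    congr 2
    ring
  rw [hmul]
  split_ifs with hnm
  · simp only [hnm, sub_self, zero_sub, zpow_neg_one]
    rw [circleIntegral.integral_sub_center_inv _ hr.ne']
  · rw [circleIntegral.integral_sub_zpow_of_ne (by omega), zero_smul]

omit [CompleteSpace E] in
theorem eq_circleCoeff_of_hasSum [FiniteDimensional ℂ E] (hr : 0 < r) {a : ℤ → E}
    (hsum : ∀ z ∈ sphere c r, HasSum (fun n : ℤ => (z - c) ^ n • a n) (g z)) (m : ℤ) :
    a m = circleCoeff g c r m := by
  have := FiniteDimensional.complete ℂ E
  have hint := hasSum_circleIntegral_zpow_smul hr hsum (-m - 1)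
  simp only [circleIntegral_zpow_smul_zpow_smul hr] at hint
  rw [circleCoeff, hint.unique (hasSum_single m fun n hn => if_neg hn), if_pos rfl, smul_smul,
    inv_mul_cancel₀ two_pi_I_ne_zero, one_smul]

theorem circleIntegral_dslope (hr : 0 ≤ r) (hg : ContinuousOn g (sphere c r))
    (hz : z ∉ sphere c r) :
    (∮ w in C(c, r), dslope g z w) =
      (∮ w in C(c, r), (w - z)⁻¹ • g w) - (∮ w in C(c, r), (w - z)⁻¹) • g z := by
  have hinv : ContinuousOn (fun w => (w - z)⁻¹) (sphere c r) :=
    (continuousOn_id.sub continuousOn_const).inv₀ fun w hw =>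
      sub_ne_zero.2 (ne_of_mem_of_not_mem hw hz)
  have hint : CircleIntegrable (fun w => (w - z)⁻¹ • g w) c r :=
    (hinv.smul hg).circleIntegrable hr
  have hconst : CircleIntegrable (fun w => (w - z)⁻¹ • g z) c r :=
    (hinv.smul continuousOn_const).circleIntegrable hr
  rw [← circleIntegral.integral_smul_const, ← circleIntegral.integral_sub hint hconst]
  refine circleIntegral.integral_congr hr fun w hw => ?_
  rw [dslope_of_ne _ (ne_of_mem_of_not_mem hw hz), slope, vsub_eq_sub, smul_sub]

theorem circleIntegral_sub_inv_eq_zero (hr : 0 ≤ r) (hrz : r < dist z c) :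
    (∮ w in C(c, r), (w - z)⁻¹) = 0 := by
  have hz : ∀ w ∈ closedBall c r, w ≠ z := fun w hw hwz => (hwz ▸ hw).not_gt hrz
  refine (DifferentiableOn.diffContOnCl_ball (U := closedBall c r) (fun w hw => ?_)
    subset_rfl).circleIntegral_eq_zero hr
  exact ((differentiableAt_id.sub_const z).inv
    (sub_ne_zero.2 (hz w hw))).differentiableWithinAt

theorem circleIntegral_sub_circleIntegral_eq (hg : DifferentiableOn ℂ g (ball c R \ {c}))
    (hr : 0 < r) (hsR : s < R) (hrz : r < dist z c) (hzs : dist z c < s) :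
    (∮ w in C(c, s), (w - z)⁻¹ • g w) - (∮ w in C(c, r), (w - z)⁻¹ • g w) =
      (2 * Real.pi * I : ℂ) • g z := by
  have hzR : z ∈ ball c R \ {c} := ⟨hzs.trans hsR, dist_pos.1 (hr.trans hrz)⟩
  have hr' : r ∈ Ioo 0 R := ⟨hr, (hrz.trans hzs).trans hsR⟩
  have hs' : s ∈ Ioo 0 R := ⟨hr.trans (hrz.trans hzs), hsR⟩
  have hd : DifferentiableOn ℂ (dslope g z) (ball c R \ {c}) :=
    (differentiableOn_dslope ((isOpen_ball.sdiff isClosed_singleton).mem_nhds hzR)).2 hg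
  have heq := circleIntegral_eq_of_differentiableOn hd hs' hr'
  rw [circleIntegral_dslope hs'.1.le (hg.continuousOn.mono (sphere_subset_ball_diff_center hs'))
      hzs.ne,
    circleIntegral_dslope hr.le (hg.continuousOn.mono (sphere_subset_ball_diff_center hr'))
      hrz.ne',
    circleIntegral.integral_sub_inv_of_mem_ball hzs,
    circleIntegral_sub_inv_eq_zero hr.le hrz, zero_smul, sub_zero, sub_eq_iff_eq_add] at heq
  rw [heq, add_sub_cancel_left]

theorem hasSum_circleCoeff (hg : DifferentiableOn ℂ g (ball c R \ {c})) (hρ : ρ ∈ Ioo 0 R)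
    (hz : z ∈ ball c R \ {c}) : HasSum (fun n : ℤ => (z - c) ^ n • circleCoeff g c ρ n) (g z) := by
  obtain ⟨r, hr, hrz⟩ := exists_between (dist_pos.2 hz.2)
  obtain ⟨s, hzs, hsR⟩ := exists_between (mem_ball.1 hz.1)
  have hr' : r ∈ Ioo 0 R := ⟨hr, hrz.trans (hzs.trans hsR)⟩
  have hs' : s ∈ Ioo 0 R := ⟨(dist_pos.2 hz.2).trans hzs, hsR⟩
  have hnat := hasSum_circleCoeff_nat
    (hg.continuousOn.mono (sphere_subset_ball_diff_center hs')) hzs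
  have hneg := hasSum_circleCoeff_neg hr
    (hg.continuousOn.mono (sphere_subset_ball_diff_center hr')) hrz
  simp only [circleCoeff_eq_of_differentiableOn hg hs' hρ] at hnat
  simp only [circleCoeff_eq_of_differentiableOn hg hr' hρ] at hneg
  have hsum := HasSum.of_nat_of_neg_add_one (f := fun n : ℤ => (z - c) ^ n • circleCoeff g c ρ n)
    hnat hneg
  rwa [← sub_eq_add_neg, ← smul_sub, circleIntegral_sub_circleIntegral_eq hg hr hsR hrz hzs,
    smul_smul, inv_mul_cancel₀ two_pi_I_ne_zero, one_smul] at hsum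

omit [CompleteSpace E] in
theorem star_circleCoeff [StarAddMonoid E] [StarModule ℂ E] [ContinuousStar E]
    [FiniteDimensional ℂ E] {y : ℝ} (hg : DifferentiableOn ℂ g (ball (y : ℂ) R \ {(y : ℂ)}))
    (hstar : ∀ z ∈ ball (y : ℂ) R \ {(y : ℂ)}, g (star z) = star (g z)) (hρ : ρ ∈ Ioo 0 R)
    (n : ℤ) : star (circleCoeff g y ρ n) = circleCoeff g y ρ n := by
  have := FiniteDimensional.complete ℂ E
  refine eq_circleCoeff_of_hasSum hρ.1 (a := fun n => star (circleCoeff g y ρ n))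
    (fun z hz => ?_) n
  have hsub : star z - y = star (z - y) := by simp
  have hmem : star z ∈ ball (y : ℂ) R \ {(y : ℂ)} := by
    refine sphere_subset_ball_diff_center hρ ?_
    rwa [mem_sphere_iff_norm, hsub, norm_star, ← mem_sphere_iff_norm]
  have hsum := (hasSum_circleCoeff hg hρ hmem).star
  simpa only [← hstar _ hmem, hsub, star_smul, star_zpow₀, star_star] using hsum

theorem circleCoeff_zero (hg : DifferentiableOn ℂ g (ball c R)) (hρ : ρ ∈ Ioo 0 R) :
    circleCoeff g c ρ 0 = g c := by
  simpa only [circleCoeff, neg_zero, zero_sub, zpow_neg_one] using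
    (hg.diffContOnCl_ball (closedBall_subset_ball
      hρ.2)).two_pi_i_inv_smul_circleIntegral_sub_inv_smul (mem_ball_self hρ.1)

theorem circleCoeff_eq_zero_of_bddAbove (hg : DifferentiableOn ℂ g (ball c R \ {c}))
    (hb : BddAbove (norm ∘ g '' (ball c R \ {c}))) (hρ : ρ ∈ Ioo 0 R) {n : ℤ} (hn : n < 0) :
    circleCoeff g c ρ n = 0 := by
  have hext := differentiableOn_update_limUnder_of_bddAbove
    (ball_mem_nhds c (hρ.1.trans hρ.2)) hg hb
  rw [circleCoeff_congr hρ.1 (fun z hz => ?_) n, circleCoeff_eq_zero_of_neg hext hρ hn]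
  exact (Function.update_of_ne (ne_of_mem_sphere hz hρ.1.ne') _ _).symm

theorem eqOn_cauchyIntegral_of_circleCoeff_eq_zero (hg : DifferentiableOn ℂ g (ball c R \ {c}))
    (hρ : ρ ∈ Ioo 0 R) (hneg : ∀ n < 0, circleCoeff g c ρ n = 0) :
    EqOn (fun z => (2 * Real.pi * I : ℂ)⁻¹ • ∮ w in C(c, ρ), (w - z)⁻¹ • g w)
      (Function.update g c (circleCoeff g c ρ 0)) (ball c ρ) := by
  intro z hz
  obtain rfl | hzc := eq_or_ne z c
  · simp [circleCoeff]
  rw [Function.update_of_ne hzc]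
  have hnat := hasSum_circleCoeff_nat
    (hg.continuousOn.mono (sphere_subset_ball_diff_center hρ)) hz
  have hzero : HasSum (fun n : ℕ => (z - c) ^ (-((n : ℤ) + 1)) •
      circleCoeff g c ρ (-((n : ℤ) + 1))) 0 := by
    convert hasSum_zero (α := E) (β := ℕ) using 2 with n
    rw [hneg _ (by omega), smul_zero]
  have hsum := HasSum.of_nat_of_neg_add_one (f := fun n : ℤ => (z - c) ^ n • circleCoeff g c ρ n)
    hnat hzero
  rw [add_zero] at hsum
  exact hsum.unique (hasSum_circleCoeff hg hρ ⟨ball_subset_ball hρ.2.le hz, hzc⟩)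

theorem differentiableOn_update_circleCoeff {D : Set ℂ} (hD : ball c R ⊆ D)
    (hg : DifferentiableOn ℂ g (D \ {c})) (hρ : ρ ∈ Ioo 0 R)
    (hneg : ∀ n < 0, circleCoeff g c ρ n = 0) :
    DifferentiableOn ℂ (Function.update g c (circleCoeff g c ρ 0)) D := by
  have hgR : DifferentiableOn ℂ g (ball c R \ {c}) := hg.mono (sdiff_subset_sdiff_left hD)
  have hcauchy : ContinuousAt
      (fun z => (2 * Real.pi * I : ℂ)⁻¹ • ∮ w in C(c, ρ), (w - z)⁻¹ • g w) c := by
    lift ρ to NNReal using hρ.1.le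
    exact (hasFPowerSeriesOn_cauchy_integral ((hgR.continuousOn.mono
      (sphere_subset_ball_diff_center hρ)).circleIntegrable hρ.1.le)
      (NNReal.coe_pos.1 hρ.1)).hasFPowerSeriesAt.continuousAt
  rw [← differentiableOn_compl_singleton_and_continuousAt_iff
    (mem_of_superset (ball_mem_nhds c (hρ.1.trans hρ.2)) hD)]
  refine ⟨hg.congr fun z hz => Function.update_of_ne hz.2 _ _, hcauchy.congr ?_⟩
  exact (eqOn_cauchyIntegral_of_circleCoeff_eq_zero hgR hρ hneg).eventuallyEq_of_mem
    (ball_mem_nhds c hρ.1)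

end Laurent

section Algebra

variable {A : Type*} [NormedAlternativeRing A]

theorem left_alternative (x y : A) : x * (x * y) = x * x * y :=
  (sub_eq_zero.1 (NormedAlternativeRing.left_alternative x y)).symm

section ImagUnits

variable [StarRing A] {J : A} (hJ : J ∈ imagUnits A)
include hJ

theorem star_eq_neg_of_mem_imagUnits : star J = -J :=
  (neg_eq_of_add_eq_zero_right hJ.1).symm

theorem mul_self_of_mem_imagUnits : J * J = -1 := by
  rw [← hJ.2, star_eq_neg_of_mem_imagUnits hJ, mul_neg, neg_neg]

theorem neg_mem_imagUnits : -J ∈ imagUnits A :=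
  ⟨by rw [star_neg, ← neg_add, hJ.1, neg_zero], by rw [star_neg, neg_mul_neg, hJ.2]⟩

end ImagUnits

variable [NormedSpace ℝ A]

theorem sliceEmb_sub (J : A) (z w : ℂ) : sliceEmb J (z - w) = sliceEmb J z - sliceEmb J w := by
  simp only [sliceEmb, Complex.sub_re, Complex.sub_im, sub_smul]
  abel

@[simp]
theorem sliceEmb_ofReal (J : A) (r : ℝ) : sliceEmb J (r : ℂ) = r • (1 : A) := by
  simp [sliceEmb]

@[simp]
theorem sliceEmb_one (J : A) : sliceEmb J 1 = 1 := by
  simp [sliceEmb]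

theorem sliceEmb_neg (J : A) (z : ℂ) : sliceEmb (-J) z = sliceEmb J (star z) := by
  simp [sliceEmb]

theorem continuous_sliceEmb (J : A) : Continuous (sliceEmb J) :=
  (Complex.continuous_re.smul continuous_const).add (Complex.continuous_im.smul continuous_const)

section Trace

variable [StarRing A] [StarModule ℝ A] {J : A} (hJ : J ∈ imagUnits A)
include hJ

theorem star_sliceEmb (z : ℂ) : star (sliceEmb J z) = sliceEmb J (star z) := by
  simp [sliceEmb, star_eq_neg_of_mem_imagUnits hJ]

theorem sliceEmb_add_star (z : ℂ) :
    sliceEmb J z + star (sliceEmb J z) = (2 * z.re) • (1 : A) := by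
  rw [star_sliceEmb hJ]
  simp only [sliceEmb, Complex.star_def, Complex.conj_re, Complex.conj_im, neg_smul, two_mul,
    add_smul]
  abel

end Trace

section Coordinates

variable [FiniteDimensional ℝ A]

variable (A) in
/-- The space `ℂⁿ`, `n = dim A`, in which the complexified algebra takes its coordinates. -/
abbrev CplxCoords : Type := Fin (Module.finrank ℝ A) → ℂ

variable (A) in
/-- The isomorphism of the complexified algebra with `ℂⁿ` given by a real basis of `A`. It
identifies multiplication by `ı` with multiplication by `i`. -/
noncomputable def cplxCoord : (A × A) ≃L[ℝ] CplxCoords A :=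
  LinearEquiv.toContinuousLinearEquiv
    { toFun := fun p i =>
        ⟨(Module.finBasis ℝ A).equivFun p.1 i, (Module.finBasis ℝ A).equivFun p.2 i⟩
      invFun := fun q => ((Module.finBasis ℝ A).equivFun.symm fun i => (q i).re,
        (Module.finBasis ℝ A).equivFun.symm fun i => (q i).im)
      left_inv := fun p => by simp
      right_inv := fun q => by simp only [LinearEquiv.apply_symm_apply]
      map_add' := fun p q => by ext i; apply Complex.ext <;> simp
      map_smul' := fun r p => by ext i; apply Complex.ext <;> simp }

theorem cplxCoord_apply (p : A × A) (i : Fin (Module.finrank ℝ A)) :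
    cplxCoord A p i =
      ⟨(Module.finBasis ℝ A).equivFun p.1 i, (Module.finBasis ℝ A).equivFun p.2 i⟩ := rfl

theorem cplxCoord_conj (p : A × A) : cplxCoord A (p.1, -p.2) = star (cplxCoord A p) := by
  ext i
  apply Complex.ext <;> simp [cplxCoord_apply]

theorem exists_cplxCoord_eq_of_star_eq {q : CplxCoords A} (hq : star q = q) :
    ∃ a : A, cplxCoord A (a, 0) = q := by
  obtain ⟨⟨a, b⟩, rfl⟩ := (cplxCoord A).surjective q
  rw [← cplxCoord_conj, EmbeddingLike.apply_eq_iff_eq] at hq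
  have hb : b = 0 := by
    have hsum : (2 : ℝ) • b = 0 := by
      rw [two_smul, ← neg_eq_iff_add_eq_zero]
      exact congrArg Prod.snd hq
    simpa using hsum
  exact ⟨a, by rw [hb]⟩

theorem isStemOn_iff {D : Set ℂ} {F : ℂ → A × A} :
    IsStemOn D F ↔ ∀ z ∈ D, cplxCoord A (F (star z)) = star (cplxCoord A (F z)) := by
  refine forall₂_congr fun z _ => ?_
  rw [← cplxCoord_conj, EmbeddingLike.apply_eq_iff_eq, Prod.ext_iff]

section

variable [SMulCommClass ℝ A A]

/-- The value `p₁ + J p₂` as a function of the coordinates of `p₁ + ı p₂`. -/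
noncomputable def coordEval (J : A) : CplxCoords A →L[ℝ] A :=
  (LinearMap.fst ℝ A A + LinearMap.mulLeft ℝ J ∘ₗ LinearMap.snd ℝ A A).toContinuousLinearMap ∘L
    (cplxCoord A).symm.toContinuousLinearMap

@[simp]
theorem coordEval_cplxCoord (J : A) (p : A × A) : coordEval J (cplxCoord A p) = evalAt J p := by
  simp [coordEval, evalAt]

theorem eq_zero_of_coordEval_eq_zero {J : A} (hJ : J * J = -1) {q : CplxCoords A}
    (hq : coordEval J q = 0) (hq' : coordEval (-J) q = 0) : q = 0 := by
  obtain ⟨⟨a, b⟩, rfl⟩ := (cplxCoord A).surjective q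
  simp only [coordEval_cplxCoord, evalAt, neg_mul] at hq hq'
  have ha : a = 0 := by
    have hsum : (2 : ℝ) • a = 0 := by
      rw [two_smul, ← add_add_sub_cancel a a (J * b), sub_eq_add_neg, hq, hq', add_zero]
    simpa using hsum
  have hb : b = 0 := by
    rw [ha, zero_add] at hq
    simpa [left_alternative, hJ] using congrArg (J * ·) hq
  rw [ha, hb, Prod.mk_zero_zero, map_zero]

/-- The representation formula: a stem function is recovered, by a continuous linear map, from
the values of the slice function on two opposite half-slices. -/
theorem exists_leftInverse_coordEval_prod {J : A} (hJ : J * J = -1) :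
    ∃ S : A × A →L[ℝ] CplxCoords A, ∀ q, S (coordEval J q, coordEval (-J) q) = q := by
  let T : CplxCoords A →ₗ[ℝ] A × A := (coordEval J).prod (coordEval (-J))
  obtain ⟨S, hS⟩ := T.exists_leftInverse_of_injective
    (LinearMap.ker_eq_bot'.2 fun q hq =>
      eq_zero_of_coordEval_eq_zero hJ (congrArg Prod.fst hq) (congrArg Prod.snd hq))
  exact ⟨S.toContinuousLinearMap, LinearMap.congr_fun hS⟩

end

end Coordinates

section IsScalarTower

variable [IsScalarTower ℝ A A]

theorem cplxMul_ofComplex (c : ℂ) (p : A × A) :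
    cplxMul (ofComplex c) p = (c.re • p.1 - c.im • p.2, c.re • p.2 + c.im • p.1) := by
  simp [cplxMul, ofComplex]

variable [FiniteDimensional ℝ A]

theorem cplxCoord_cplxMul_ofComplex (c : ℂ) (p : A × A) :
    cplxCoord A (cplxMul (ofComplex c) p) = c • cplxCoord A p := by
  ext i
  apply Complex.ext <;> simp [cplxCoord_apply, cplxMul_ofComplex]

theorem dbar_eq_zero_iff {F : ℂ → A × A} {z : ℂ} (hF : DifferentiableAt ℝ F z) :
    dbar F z = 0 ↔ DifferentiableAt ℂ (cplxCoord A ∘ F) z := by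
  have hI : ∀ p : A × A, cplxMul (0, 1) p = (-p.2, p.1) := fun p => by simp [cplxMul]
  have hcI : ∀ p : A × A, Complex.I • cplxCoord A p = cplxCoord A (-p.2, p.1) := fun p => by
    rw [← cplxCoord_cplxMul_ofComplex, cplxMul_ofComplex]
    simp
  rw [differentiableAt_complex_iff_differentiableAt_real, (cplxCoord A).comp_fderiv,
    and_iff_right ((cplxCoord A).differentiableAt.comp z hF)]
  simp only [ContinuousLinearMap.comp_apply, ContinuousLinearEquiv.coe_coe, hcI,
    EmbeddingLike.apply_eq_iff_eq, dbar, hI]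
  rw [smul_eq_zero, or_iff_right (by norm_num), Prod.ext_iff, Prod.ext_iff]
  simp only [Prod.fst_add, Prod.snd_add, Prod.fst_zero, Prod.snd_zero]
  rw [add_neg_eq_zero, add_comm, add_eq_zero_iff_eq_neg, and_comm,
    eq_comm (a := (fderiv ℝ F z 1).1), and_comm]

theorem contDiffOn_and_dbar_eq_zero_iff {F : ℂ → A × A} {D : Set ℂ} (hD : IsOpen D) :
    (ContDiffOn ℝ 1 F D ∧ ∀ z ∈ D, dbar F z = 0) ↔ DifferentiableOn ℂ (cplxCoord A ∘ F) D := by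
  have hdbar : ContDiffOn ℝ 1 F D → ∀ z ∈ D,
      (dbar F z = 0 ↔ DifferentiableAt ℂ (cplxCoord A ∘ F) z) := fun hF z hz =>
    dbar_eq_zero_iff ((hF.differentiableOn one_ne_zero).differentiableAt (hD.mem_nhds hz))
  refine ⟨fun ⟨hF, h0⟩ z hz => ((hdbar hF z hz).1 (h0 z hz)).differentiableWithinAt, fun hd => ?_⟩
  have hF : ContDiffOn ℝ 1 F D := ((cplxCoord A).symm.contDiff.comp_contDiffOn
    ((hd.contDiffOn hD).restrict_scalars ℝ)).congr fun z _ => by simp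
  exact ⟨hF, fun z hz => (hdbar hF z hz).2 (hd.differentiableAt (hD.mem_nhds hz))⟩

end IsScalarTower

variable [IsScalarTower ℝ A A] [SMulCommClass ℝ A A]

section Mul

variable {J : A} (hJ : J * J = -1)
include hJ

theorem sliceEmb_mul_evalAt (c : ℂ) (p : A × A) :
    sliceEmb J c * evalAt J p = evalAt J (cplxMul (ofComplex c) p) := by
  have hJJ : J * (J * p.2) = -p.2 := by rw [left_alternative, hJ, neg_mul, one_mul]
  simp only [sliceEmb, evalAt, cplxMul_ofComplex, add_mul, mul_add, smul_mul_assoc, one_mul,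
    mul_smul_comm, hJJ, smul_neg]
  abel

theorem sliceEmb_mul (z w : ℂ) : sliceEmb J (z * w) = sliceEmb J z * sliceEmb J w := by
  have heval : ∀ c, sliceEmb J c = evalAt J (ofComplex c) := fun c => by
    simp [sliceEmb, evalAt, ofComplex]
  rw [heval w, sliceEmb_mul_evalAt hJ, heval, cplxMul_ofComplex]
  simp [ofComplex, smul_smul, sub_smul, add_smul]

theorem pow_sliceEmb (z : ℂ) (k : ℕ) : pow (sliceEmb J z) k = sliceEmb J (z ^ k) := by
  induction k with
  | zero => simp [pow]
  | succ k ih => rw [pow, ih, ← sliceEmb_mul hJ, pow_succ']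

theorem pow_sliceEmb_sub (z : ℂ) (y : ℝ) (k : ℕ) :
    pow (sliceEmb J z - y • (1 : A)) k = sliceEmb J ((z - y) ^ k) := by
  rw [← sliceEmb_ofReal J, ← sliceEmb_sub, pow_sliceEmb hJ]

end Mul

section Star

variable [StarRing A] [StarModule ℝ A] {J : A} (hJ : J ∈ imagUnits A)
include hJ

theorem sliceEmb_mul_star (z : ℂ) :
    sliceEmb J z * star (sliceEmb J z) = (‖z‖ ^ 2) • (1 : A) := by
  rw [star_sliceEmb hJ, ← sliceEmb_mul (mul_self_of_mem_imagUnits hJ), Complex.star_def,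
    Complex.mul_conj, ← Complex.sq_norm, sliceEmb_ofReal]

theorem sliceEmb_mem_quadraticCone (z : ℂ) : sliceEmb J z ∈ quadraticCone A := by
  by_cases hz : z.im = 0
  · exact Or.inl ⟨z.re, by simp [sliceEmb, hz]⟩
  · refine Or.inr ⟨2 * z.re, ‖z‖ ^ 2, sliceEmb_add_star hJ z, sliceEmb_mul_star hJ z, ?_⟩
    rw [Complex.sq_norm, Complex.normSq_apply]
    nlinarith [mul_self_pos.2 hz]

theorem IsOpenInCone.isOpen_preimage {Ω : Set A} (hΩ : IsOpenInCone Ω) :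
    IsOpen (sliceEmb J ⁻¹' Ω) := by
  obtain ⟨U, hU, rfl⟩ := hΩ
  convert hU.preimage (continuous_sliceEmb J) using 1
  ext z
  exact and_iff_left (sliceEmb_mem_quadraticCone hJ z)

variable [Nontrivial A]

theorem eq_or_eq_star_of_sliceEmb_eq {J' : A} (hJ' : J' ∈ imagUnits A) {z w : ℂ}
    (hzw : sliceEmb J z = sliceEmb J' w) : z = w ∨ z = star w := by
  have hinj : Function.Injective fun r : ℝ => r • (1 : A) := smul_left_injective ℝ one_ne_zero
  have htrace : 2 * z.re = 2 * w.re := hinj <| by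
    simp only [← sliceEmb_add_star hJ, hzw, sliceEmb_add_star hJ']
  have hnorm : ‖z‖ ^ 2 = ‖w‖ ^ 2 := hinj <| by
    simp only [← sliceEmb_mul_star hJ, hzw, sliceEmb_mul_star hJ']
  have hre : z.re = w.re := by linarith
  simp only [Complex.sq_norm, Complex.normSq_apply, hre, add_right_inj] at hnorm
  exact (mul_self_eq_mul_self_iff.1 hnorm).imp (fun him => Complex.ext hre him)
    fun him => Complex.ext (by simpa using hre) (by simpa using him)

theorem sliceEmb_eq_smul_one_iff {z : ℂ} {y : ℝ} : sliceEmb J z = y • (1 : A) ↔ z = y := by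
  refine ⟨fun hz => ?_, fun hz => hz ▸ sliceEmb_ofReal J y⟩
  rw [← sliceEmb_ofReal J] at hz
  simpa using eq_or_eq_star_of_sliceEmb_eq hJ hJ hz

theorem preimage_sliceEmb_diff (Ω : Set A) (y : ℝ) :
    sliceEmb J ⁻¹' (Ω \ {y • (1 : A)}) = (sliceEmb J ⁻¹' Ω) \ {(y : ℂ)} := by
  ext z
  simp [sliceEmb_eq_smul_one_iff hJ]

theorem preimage_circularization {D : Set ℂ} (hD : ∀ z ∈ D, star z ∈ D) :
    sliceEmb J ⁻¹' circularization A D = D := by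
  refine Set.Subset.antisymm ?_ fun z hz => ⟨sliceEmb_mem_quadraticCone hJ z, z, hz, J, hJ, rfl⟩
  rintro z ⟨-, w, hw, J', hJ', hzw⟩
  obtain rfl | rfl := eq_or_eq_star_of_sliceEmb_eq hJ hJ' hzw
  exacts [hw, hD _ hw]

theorem IsCircular.sliceEmb_mem {Ω : Set A} (hΩ : IsCircular Ω) {J' : A} (hJ' : J' ∈ imagUnits A)
    {z : ℂ} (hz : sliceEmb J z ∈ Ω) : sliceEmb J' z ∈ Ω := by
  obtain ⟨E, rfl⟩ := hΩ
  obtain ⟨-, w, hw, J₁, hJ₁, hzw⟩ := hz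
  refine ⟨sliceEmb_mem_quadraticCone hJ' z, w, hw, ?_⟩
  obtain rfl | rfl := eq_or_eq_star_of_sliceEmb_eq hJ hJ₁ hzw
  · exact ⟨J', hJ', rfl⟩
  · exact ⟨-J', neg_mem_imagUnits hJ', (sliceEmb_neg _ _).symm⟩

theorem IsCircular.star_mem {Ω : Set A} (hΩ : IsCircular Ω) {z : ℂ} (hz : sliceEmb J z ∈ Ω) :
    sliceEmb J (star z) ∈ Ω :=
  sliceEmb_neg J z ▸ hΩ.sliceEmb_mem hJ (neg_mem_imagUnits hJ) hz

theorem IsCircular.exists_eq_sliceEmb {Ω : Set A} (hΩ : IsCircular Ω) {x : A} (hx : x ∈ Ω) :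
    ∃ z, sliceEmb J z ∈ Ω ∧ ∃ J' ∈ imagUnits A, x = sliceEmb J' z := by
  obtain ⟨E, rfl⟩ := id hΩ
  obtain ⟨-, z, -, J', hJ', rfl⟩ := id hx
  exact ⟨z, hΩ.sliceEmb_mem hJ' hJ hx, J', hJ', rfl⟩

theorem IsCircular.eq_circularization {Ω : Set A} (hΩ : IsCircular Ω) :
    Ω = circularization A (sliceEmb J ⁻¹' Ω) := by
  ext x
  refine ⟨fun hx => ?_, ?_⟩
  · obtain ⟨z, hz, J', hJ', rfl⟩ := hΩ.exists_eq_sliceEmb hJ hx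
    exact ⟨sliceEmb_mem_quadraticCone hJ' z, z, hz, J', hJ', rfl⟩
  · rintro ⟨-, z, hz, J', hJ', rfl⟩
    exact hΩ.sliceEmb_mem hJ hJ' hz

section Norm

variable (hnorm : ∀ x ∈ quadraticCone A, (‖x‖ ^ 2) • (1 : A) = x * star x)
include hnorm

theorem norm_sliceEmb (z : ℂ) : ‖sliceEmb J z‖ = ‖z‖ := by
  have hsq := (hnorm _ (sliceEmb_mem_quadraticCone hJ z)).trans (sliceEmb_mul_star hJ z)
  exact (sq_eq_sq₀ (norm_nonneg _) (norm_nonneg _)).1 (smul_left_injective ℝ one_ne_zero hsq)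

theorem norm_sliceEmb_sub (z : ℂ) (y : ℝ) : ‖sliceEmb J z - y • (1 : A)‖ = ‖z - y‖ := by
  rw [← sliceEmb_ofReal J, ← sliceEmb_sub, norm_sliceEmb hJ hnorm]

theorem norm_eq_one_of_mem_imagUnits : ‖J‖ = 1 := by
  simpa [sliceEmb] using norm_sliceEmb hJ hnorm Complex.I

omit hJ in
theorem IsCircular.norm_pow_sub {Ω : Set A} (hΩ : IsCircular Ω) {x : A} (hx : x ∈ Ω) (y : ℝ)
    (k : ℕ) : ‖pow (x - y • (1 : A)) k‖ = ‖x - y • (1 : A)‖ ^ k := by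
  obtain ⟨E, rfl⟩ := hΩ
  obtain ⟨-, z, -, J', hJ', rfl⟩ := hx
  rw [pow_sliceEmb_sub (mul_self_of_mem_imagUnits hJ'), norm_sliceEmb hJ' hnorm,
    norm_sliceEmb_sub hJ' hnorm, norm_pow]

theorem sliceEmb_mem_puncturedBall_iff {z : ℂ} {y R : ℝ} :
    sliceEmb J z ∈ (puncturedBall y R : Set A) ↔ z ∈ Metric.ball (y : ℂ) R \ {(y : ℂ)} := by
  rw [puncturedBall, Set.mem_ofPred_eq, norm_sliceEmb_sub hJ hnorm]
  simp only [sliceEmb_mem_quadraticCone hJ, true_and, norm_pos_iff, sub_ne_zero, Set.mem_sdiff,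
    Metric.mem_ball, dist_eq_norm, Set.mem_singleton_iff]
  exact and_comm

theorem ball_diff_subset_preimage {Ω : Set A} {y R : ℝ} (hR : puncturedBall y R ⊆ Ω) :
    Metric.ball (y : ℂ) R \ {(y : ℂ)} ⊆ sliceEmb J ⁻¹' Ω :=
  fun _ hz => hR ((sliceEmb_mem_puncturedBall_iff hJ hnorm).2 hz)

end Norm

end Star

section NormBounds

variable [FiniteDimensional ℝ A]

theorem exists_norm_mul_le : ∃ C > 0, ∀ x y : A, ‖x * y‖ ≤ C * ‖x‖ * ‖y‖ := by
  let B : A →L[ℝ] A →L[ℝ] A := (LinearMap.mul ℝ A).toContinuousBilinearMap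
  refine ⟨‖B‖ + 1, by positivity, fun x y => (B.le_opNorm₂ x y).trans ?_⟩
  gcongr
  exact le_add_of_nonneg_right zero_le_one

theorem coordEval_smul {J : A} (hJ : J * J = -1) (c : ℂ) (q : CplxCoords A) :
    coordEval J (c • q) = sliceEmb J c * coordEval J q := by
  obtain ⟨p, rfl⟩ := (cplxCoord A).surjective q
  rw [← cplxCoord_cplxMul_ofComplex, coordEval_cplxCoord, coordEval_cplxCoord,
    sliceEmb_mul_evalAt hJ]

theorem laurentTerm_eq_coordEval (y : ℝ) (n : ℤ) (a J : A) (z : ℂ) :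
    laurentTerm y n a J z = coordEval J ((z - y) ^ n • cplxCoord A (a, 0)) := by
  rw [laurentTerm, ← cplxCoord_cplxMul_ofComplex, coordEval_cplxCoord]

theorem exists_norm_coordEval_le [StarRing A] [StarModule ℝ A] [Nontrivial A]
    (hnorm : ∀ x ∈ quadraticCone A, (‖x‖ ^ 2) • (1 : A) = x * star x) :
    ∃ C > 0, ∀ J ∈ imagUnits A, ∀ q : CplxCoords A, ‖coordEval J q‖ ≤ C * ‖q‖ := by
  obtain ⟨C, hC, hmul⟩ := exists_norm_mul_le (A := A)
  let N := ‖(cplxCoord A).symm.toContinuousLinearMap‖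
  refine ⟨(1 + C) * (N + 1), by positivity, fun J hJ q => ?_⟩
  obtain ⟨p, rfl⟩ := (cplxCoord A).surjective q
  have hp : ‖p‖ ≤ N * ‖cplxCoord A p‖ := by
    simpa using (cplxCoord A).symm.toContinuousLinearMap.le_opNorm (cplxCoord A p)
  have hJp : ‖J * p.2‖ ≤ C * ‖p.2‖ := by
    simpa only [norm_eq_one_of_mem_imagUnits hJ hnorm, mul_one] using hmul J p.2
  calc ‖coordEval J (cplxCoord A p)‖ ≤ ‖p.1‖ + ‖J * p.2‖ := by
        rw [coordEval_cplxCoord]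
        exact norm_add_le _ _
    _ ≤ ‖p‖ + C * ‖p‖ := add_le_add (norm_fst_le p)
        (hJp.trans (mul_le_mul_of_nonneg_left (norm_snd_le p) hC.le))
    _ = (1 + C) * ‖p‖ := by ring
    _ ≤ (1 + C) * ((N + 1) * ‖cplxCoord A p‖) := by
        gcongr
        exact hp.trans (by gcongr; exact le_add_of_nonneg_right zero_le_one)
    _ = (1 + C) * (N + 1) * ‖cplxCoord A p‖ := by ring

end NormBounds

end Algebra

section Stem

open Metric Set

variable {A : Type*} [NormedAlternativeRing A] [NormedSpace ℝ A] [SMulCommClass ℝ A A]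
  [StarRing A] [FiniteDimensional ℝ A] {D D' : Set ℂ} {Φ : ℂ → CplxCoords A} {f g : A → A}

/-- A stem function, read in the coordinates of `ℂⁿ`, that is holomorphic on `D` and induces the
slice function `f` there. -/
structure IsHolomorphicStem (D : Set ℂ) (Φ : ℂ → CplxCoords A) (f : A → A) : Prop where
  map_star : ∀ z ∈ D, Φ (star z) = star (Φ z)
  differentiableOn : DifferentiableOn ℂ Φ D
  induces : ∀ z ∈ D, ∀ J ∈ imagUnits A, f (sliceEmb J z) = coordEval J (Φ z)

theorem IsHolomorphicStem.mono (h : IsHolomorphicStem D Φ f) (hD : D' ⊆ D) :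
    IsHolomorphicStem D' Φ f :=
  ⟨fun z hz => h.map_star z (hD hz), h.differentiableOn.mono hD, fun z hz => h.induces z (hD hz)⟩

theorem IsHolomorphicStem.congr (h : IsHolomorphicStem D Φ f)
    (hfg : ∀ z ∈ D, ∀ J ∈ imagUnits A, f (sliceEmb J z) = g (sliceEmb J z)) :
    IsHolomorphicStem D Φ g :=
  ⟨h.map_star, h.differentiableOn, fun z hz J hJ => hfg z hz J hJ ▸ h.induces z hz J hJ⟩

variable [IsScalarTower ℝ A A]

theorem IsHolomorphicStem.pow_mul (h : IsHolomorphicStem D Φ f) (y : ℝ) (k : ℕ) :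
    IsHolomorphicStem D (fun z => (z - y) ^ k • Φ z) (fun x => pow (x - y • (1 : A)) k * f x) where
  map_star z hz := by
    rw [h.map_star z hz]
    simp
  differentiableOn := by
    have hΦ := h.differentiableOn
    fun_prop
  induces z hz J hJ := by
    have hJJ := mul_self_of_mem_imagUnits hJ
    rw [pow_sliceEmb_sub hJJ, coordEval_smul hJJ, h.induces z hz J hJ]

variable [StarModule ℝ A] [Nontrivial A] {J : A} (hJ : J ∈ imagUnits A)
include hJ

theorem sliceRegularOn_iff {Ω : Set A} :
    SliceRegularOn f Ω ↔ IsCircular Ω ∧ IsOpenInCone Ω ∧ (sliceEmb J ⁻¹' Ω).Nonempty ∧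
      ∃ Φ, IsHolomorphicStem (sliceEmb J ⁻¹' Ω) Φ f := by
  constructor
  · rintro ⟨hopen, D, hne, hstar, rfl, F, hF, hind, hreg⟩
    have hD := hopen.isOpen_preimage hJ
    rw [preimage_circularization hJ hstar] at hD ⊢
    exact ⟨⟨D, rfl⟩, hopen, hne, cplxCoord A ∘ F, isStemOn_iff.1 hF,
      (contDiffOn_and_dbar_eq_zero_iff hD).1 hreg,
      fun z hz K hK => (hind z hz K hK).trans (coordEval_cplxCoord K (F z)).symm⟩
  · rintro ⟨hcirc, hopen, hne, Φ, hΦ⟩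
    refine ⟨hopen, _, hne, fun z hz => hcirc.star_mem hJ hz, hcirc.eq_circularization hJ,
      (cplxCoord A).symm ∘ Φ, isStemOn_iff.2 fun z hz => ?_, fun z hz K hK => ?_,
      (contDiffOn_and_dbar_eq_zero_iff (hopen.isOpen_preimage hJ)).2
        (hΦ.differentiableOn.congr fun z _ => ?_)⟩
    · simpa using hΦ.map_star z hz
    · rw [hΦ.induces z hz K hK, Function.comp_apply, ← coordEval_cplxCoord,
        ContinuousLinearEquiv.apply_symm_apply]
    · simp

theorem SliceRegularOn.pow_mul {Ω : Set A} (hf : SliceRegularOn f Ω) (y : ℝ) (k : ℕ) :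
    SliceRegularOn (fun x => pow (x - y • (1 : A)) k * f x) Ω := by
  obtain ⟨hcirc, hopen, hne, Φ, hΦ⟩ := (sliceRegularOn_iff hJ).1 hf
  exact (sliceRegularOn_iff hJ).2 ⟨hcirc, hopen, hne, _, hΦ.pow_mul y k⟩

variable (hnorm : ∀ x ∈ quadraticCone A, (‖x‖ ^ 2) • (1 : A) = x * star x)
include hnorm

theorem SliceRegularOn.continuousWithinAt {Ω : Set A} (hf : SliceRegularOn f Ω) {y : ℝ}
    (hy : y • (1 : A) ∈ Ω) : ContinuousWithinAt f Ω (y • (1 : A)) := by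
  obtain ⟨hcirc, hopen, -, Φ, hΦ⟩ := (sliceRegularOn_iff hJ).1 hf
  obtain ⟨C, hC, hbound⟩ := exists_norm_coordEval_le hnorm
  have hyD : (y : ℂ) ∈ sliceEmb J ⁻¹' Ω := by simpa using hy
  have hΦy : ContinuousAt Φ y := (hΦ.differentiableOn.differentiableAt
    ((hopen.isOpen_preimage hJ).mem_nhds hyD)).continuousAt
  refine Metric.continuousWithinAt_iff.2 fun ε hε => ?_
  obtain ⟨δ, hδ, hδΦ⟩ := Metric.continuousAt_iff.1 hΦy (ε / C) (div_pos hε hC)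
  refine ⟨δ, hδ, fun {x} hx hxy => ?_⟩
  obtain ⟨z, hz, K, hK, rfl⟩ := hcirc.exists_eq_sliceEmb hJ hx
  rw [dist_eq_norm, norm_sliceEmb_sub hK hnorm, ← dist_eq_norm] at hxy
  rw [dist_eq_norm, ← sliceEmb_ofReal K y, hΦ.induces z hz K hK, hΦ.induces y hyD K hK, ← map_sub]
  calc ‖coordEval K (Φ z - Φ y)‖ ≤ C * dist (Φ z) (Φ y) := dist_eq_norm (Φ z) _ ▸ hbound K hK _
    _ < C * (ε / C) := by gcongr; exact hδΦ hxy
    _ = ε := mul_div_cancel₀ ε hC.ne'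

section Laurent

variable {Ω : Set A} {y R ρ : ℝ} (hΦ : IsHolomorphicStem (ball (y : ℂ) R \ {(y : ℂ)}) Φ f)
  (hρ : ρ ∈ Ioo 0 R)
include hΦ hρ

omit hJ in
theorem IsHolomorphicStem.exists_hasLaurentExpansion (hsub : puncturedBall y R ⊆ Ω) :
    ∃ a, HasLaurentExpansion Ω f y a := by
  choose a ha using fun n => exists_cplxCoord_eq_of_star_eq
    (star_circleCoeff hΦ.differentiableOn hΦ.map_star hρ n)
  refine ⟨a, R, hρ.1.trans hρ.2, hsub, fun z K hK hz => ?_⟩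
  replace hz := (sliceEmb_mem_puncturedBall_iff hK hnorm).1 hz
  simp only [laurentTerm_eq_coordEval, hΦ.induces z hz K hK, ha]
  exact (hasSum_circleCoeff hΦ.differentiableOn hρ hz).mapL (coordEval K)

/-- Laurent coefficients of `f` are those of its stem: the expansions of `f` on the opposite
half-slices of `J` and `-J` combine, by the representation formula, to one of the stem. -/
theorem HasLaurentExpansion.cplxCoord_eq {a : ℤ → A} (ha : HasLaurentExpansion Ω f y a) (n : ℤ) :
    cplxCoord A (a n, 0) = circleCoeff Φ y ρ n := by
  obtain ⟨R', hR', -, hsum⟩ := ha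
  obtain ⟨S, hS⟩ := exists_leftInverse_coordEval_prod (mul_self_of_mem_imagUnits hJ)
  obtain ⟨r, hr, hrlt⟩ := exists_between (lt_min hR' (hρ.1.trans hρ.2))
  have hrR : r ∈ Ioo 0 R := ⟨hr, hrlt.trans_le (min_le_right _ _)⟩
  have hrR' : r ∈ Ioo 0 R' := ⟨hr, hrlt.trans_le (min_le_left _ _)⟩
  rw [circleCoeff_eq_of_differentiableOn hΦ.differentiableOn hρ hrR]
  refine eq_circleCoeff_of_hasSum hr (a := fun n => cplxCoord A (a n, 0)) (fun z hz => ?_) n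
  have hsumK : ∀ K ∈ imagUnits A, HasSum
      (fun n : ℤ => coordEval K ((z - y) ^ n • cplxCoord A (a n, 0))) (coordEval K (Φ z)) := by
    intro K hK
    simp only [← hΦ.induces z (sphere_subset_ball_diff_center hrR hz) K hK,
      ← laurentTerm_eq_coordEval]
    exact hsum z K hK ((sliceEmb_mem_puncturedBall_iff hK hnorm).2
      (sphere_subset_ball_diff_center hrR' hz))
  simpa only [hS] using ((hsumK J hJ).prodMk (hsumK (-J) (neg_mem_imagUnits hJ))).mapL S

theorem IsHolomorphicStem.existsUnique_hasLaurentExpansion (hsub : puncturedBall y R ⊆ Ω) :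
    ∃! a, HasLaurentExpansion Ω f y a := by
  refine existsUnique_of_exists_of_unique (hΦ.exists_hasLaurentExpansion hnorm hρ hsub)
    fun a b ha hb => funext fun n => ?_
  have hab := (ha.cplxCoord_eq hJ hnorm hΦ hρ n).trans (hb.cplxCoord_eq hJ hnorm hΦ hρ n).symm
  exact congrArg Prod.fst ((cplxCoord A).injective hab)

theorem IsHolomorphicStem.cplxCoord_laurentCoeff (hsub : puncturedBall y R ⊆ Ω) (n : ℤ) :
    cplxCoord A (laurentCoeff Ω f y n, 0) = circleCoeff Φ y ρ n := by
  have hex := hΦ.exists_hasLaurentExpansion hnorm hρ hsub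
  rw [laurentCoeff, dif_pos hex]
  exact hex.choose_spec.cplxCoord_eq hJ hnorm hΦ hρ n

theorem IsHolomorphicStem.laurentCoeff_eq_zero_iff (hsub : puncturedBall y R ⊆ Ω) (n : ℤ) :
    laurentCoeff Ω f y n = 0 ↔ circleCoeff Φ y ρ n = 0 := by
  rw [← hΦ.cplxCoord_laurentCoeff hJ hnorm hρ hsub, map_eq_zero_iff _ (cplxCoord A).injective,
    Prod.mk_eq_zero, and_iff_left rfl]

end Laurent

end Stem

section Order

variable {A : Type*} [NormedAlternativeRing A] [NormedSpace ℝ A] [StarRing A] {Ω : Set A}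
  {f : A → A} {y : ℝ}

theorem order_le_natCast_iff {k : ℕ} :
    order Ω f y ≤ k ↔ ∀ n : ℕ, k < n → laurentCoeff Ω f y (-(n : ℤ)) = 0 := by
  refine ⟨fun hk n hn => ?_, fun hk => sInf_le ⟨k, hk, rfl⟩⟩
  obtain ⟨_, ⟨m, hm, rfl⟩, hmn⟩ := sInf_lt_iff.1 (hk.trans_lt (Nat.cast_lt.2 hn))
  exact hm n (Nat.cast_lt.1 hmn)

theorem order_eq_zero_iff : order Ω f y = 0 ↔ ∀ n < 0, laurentCoeff Ω f y n = 0 := by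
  rw [← nonpos_iff_eq_zero, ← Nat.cast_zero, order_le_natCast_iff]
  refine ⟨fun h n hn => ?_, fun h n hn => h _ (by omega)⟩
  simpa [abs_of_neg hn] using h n.natAbs (by omega)

theorem order_eq_natCast_iff {k : ℕ} (hk : k ≠ 0) :
    order Ω f y = k ↔ order Ω f y ≤ k ∧ laurentCoeff Ω f y (-(k : ℤ)) ≠ 0 := by
  obtain ⟨m, rfl⟩ := Nat.exists_eq_succ_of_ne_zero hk
  rw [le_antisymm_iff, and_congr_right_iff]
  intro hle
  rw [Nat.cast_succ, ENat.add_one_le_iff (ENat.natCast_ne_top m), ← not_le, not_iff_not,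
    order_le_natCast_iff]
  refine ⟨fun h => by simpa using h _ m.lt_succ_self, fun h n hn => ?_⟩
  obtain rfl | hn := (Nat.succ_le_of_lt hn).eq_or_lt
  · exact h
  · exact order_le_natCast_iff.1 hle n hn

theorem isPole_iff : IsPole Ω f y ↔ IsSingularity Ω y ∧ order Ω f y ≠ ⊤ := by
  simp only [IsPole, ← order_le_natCast_iff]
  exact and_congr_right fun _ => ⟨fun ⟨m, hm⟩ => (hm.trans_lt (ENat.natCast_lt_top m)).ne,
    fun h => ⟨_, (ENat.natCast_toNat h).ge⟩⟩

theorem isEssentialSingularity_iff :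
    IsEssentialSingularity Ω f y ↔ IsSingularity Ω y ∧ order Ω f y = ⊤ := by
  rw [IsEssentialSingularity, isPole_iff]
  tauto

end Order

section IsolatedSingularity

open Metric Set

variable {A : Type*} [NormedAlternativeRing A] [NormedSpace ℝ A] [StarRing A] {Ω : Set A}
  {f g : A → A} {y : ℝ}

/-- `f` is slice regular on the circular open set `Ω`, except possibly at its real point `y`. -/
structure HasIsolatedSingularity (Ω : Set A) (f : A → A) (y : ℝ) : Prop where
  isCircular : IsCircular Ω
  isOpenInCone : IsOpenInCone Ω
  mem : y • (1 : A) ∈ Ω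
  sliceRegularOn : SliceRegularOn f (Ω \ {y • (1 : A)})

theorem IsOpenInCone.isSingularity (hΩ : IsOpenInCone Ω) (hy : y • (1 : A) ∈ Ω) :
    IsSingularity (Ω \ {y • (1 : A)}) y := by
  obtain ⟨U, hU, rfl⟩ := hΩ
  obtain ⟨R, hR, hball⟩ := Metric.isOpen_iff.1 hU _ hy.1
  exact ⟨R, hR, fun x hx => ⟨⟨hball (mem_ball_iff_norm.2 hx.2.2), hx.1⟩,
    sub_ne_zero.1 (norm_pos_iff.1 hx.2.1)⟩⟩

namespace HasIsolatedSingularity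

theorem isSingularity (h : HasIsolatedSingularity Ω f y) :
    IsSingularity (Ω \ {y • (1 : A)}) y :=
  h.isOpenInCone.isSingularity h.mem

theorem isEssentialSingularity_iff_order_eq_top (h : HasIsolatedSingularity Ω f y) :
    IsEssentialSingularity (Ω \ {y • (1 : A)}) f y ↔ order (Ω \ {y • (1 : A)}) f y = ⊤ := by
  rw [isEssentialSingularity_iff, and_iff_right h.isSingularity]

variable [IsScalarTower ℝ A A] [SMulCommClass ℝ A A] [FiniteDimensional ℝ A] [StarModule ℝ A]
  [Nontrivial A] {J : A} (hJ : J ∈ imagUnits A)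
  (hnorm : ∀ x ∈ quadraticCone A, (‖x‖ ^ 2) • (1 : A) = x * star x)
include hJ

theorem pow_mul (h : HasIsolatedSingularity Ω f y) (k : ℕ) :
    HasIsolatedSingularity Ω (fun x => pow (x - y • (1 : A)) k * f x) y :=
  ⟨h.isCircular, h.isOpenInCone, h.mem, h.sliceRegularOn.pow_mul hJ y k⟩

variable (h : HasIsolatedSingularity Ω f y)
include h

include hnorm in
theorem exists_stem :
    ∃ Φ R, 0 < R ∧ IsHolomorphicStem (sliceEmb J ⁻¹' Ω \ {(y : ℂ)}) Φ f ∧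
      ball (y : ℂ) R ⊆ sliceEmb J ⁻¹' Ω ∧ puncturedBall y R ⊆ Ω \ {y • (1 : A)} := by
  obtain ⟨-, -, -, Φ, hΦ⟩ := (sliceRegularOn_iff hJ).1 h.sliceRegularOn
  obtain ⟨R, hR, hsub⟩ := h.isSingularity
  refine ⟨Φ, R, hR, preimage_sliceEmb_diff hJ Ω y ▸ hΦ, fun z hz => ?_, hsub⟩
  obtain rfl | hzy := eq_or_ne z y
  · simpa using h.mem
  · exact (ball_diff_subset_preimage hJ hnorm hsub ⟨hz, hzy⟩).1

include hnorm

theorem existsUnique_hasLaurentExpansion :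
    ∃! a, HasLaurentExpansion (Ω \ {y • (1 : A)}) f y a := by
  obtain ⟨Φ, R, hR, hΦ, hball, hsub⟩ := h.exists_stem hJ hnorm
  exact (hΦ.mono (sdiff_subset_sdiff_left hball)).existsUnique_hasLaurentExpansion hJ hnorm
    ⟨half_pos hR, half_lt_self hR⟩ hsub

theorem laurentCoeff_pow_mul (k : ℕ) (n : ℤ) :
    laurentCoeff (Ω \ {y • (1 : A)}) (fun x => pow (x - y • (1 : A)) k * f x) y n =
      laurentCoeff (Ω \ {y • (1 : A)}) f y (n - k) := by
  obtain ⟨Φ, R, hR, hΦ, hball, hsub⟩ := h.exists_stem hJ hnorm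
  replace hΦ := hΦ.mono (sdiff_subset_sdiff_left hball)
  have hρ : R / 2 ∈ Ioo 0 R := ⟨half_pos hR, half_lt_self hR⟩
  have hcoeff := (hΦ.pow_mul y k).cplxCoord_laurentCoeff hJ hnorm hρ hsub n
  simp only [← zpow_natCast] at hcoeff
  rw [circleCoeff_zpow_smul hρ.1, ← hΦ.cplxCoord_laurentCoeff hJ hnorm hρ hsub] at hcoeff
  exact congrArg Prod.fst ((cplxCoord A).injective hcoeff)

theorem order_pow_mul_eq_zero_iff (k : ℕ) :
    order (Ω \ {y • (1 : A)}) (fun x => pow (x - y • (1 : A)) k * f x) y = 0 ↔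
      order (Ω \ {y • (1 : A)}) f y ≤ k := by
  simp only [order_eq_zero_iff, order_le_natCast_iff, h.laurentCoeff_pow_mul hJ hnorm]
  refine ⟨fun hk n hn => ?_, fun hk n hn => ?_⟩
  · simpa using hk (k - n) (by omega)
  · obtain ⟨m, hm⟩ := Int.eq_ofNat_of_zero_le (show 0 ≤ k - n by omega)
    rw [← neg_sub, hm]
    exact hk m (by omega)

/-- Riemann's theorem for the stem: its extension to `y` is again a stem, since the coefficient of
index `0` is real. -/
theorem exists_extension_of_order_eq_zero (h0 : order (Ω \ {y • (1 : A)}) f y = 0) :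
    ∃ g, SliceRegularOn g Ω ∧ EqOn g f (Ω \ {y • (1 : A)}) ∧
      g (y • (1 : A)) = laurentCoeff (Ω \ {y • (1 : A)}) f y 0 := by
  classical
  obtain ⟨Φ, R, hR, hΦ, hball, hsub⟩ := h.exists_stem hJ hnorm
  have hρ : R / 2 ∈ Ioo 0 R := ⟨half_pos hR, half_lt_self hR⟩
  have hΦR := hΦ.mono (sdiff_subset_sdiff_left hball)
  let a := laurentCoeff (Ω \ {y • (1 : A)}) f y
  have ha : cplxCoord A (a 0, 0) = circleCoeff Φ y (R / 2) 0 :=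
    hΦR.cplxCoord_laurentCoeff hJ hnorm hρ hsub 0
  have hneg : ∀ n < 0, circleCoeff Φ y (R / 2) n = 0 := fun n hn =>
    (hΦR.laurentCoeff_eq_zero_iff hJ hnorm hρ hsub n).1 (order_eq_zero_iff.1 h0 n hn)
  refine ⟨Function.update f (y • (1 : A)) (a 0), (sliceRegularOn_iff hJ).2
    ⟨h.isCircular, h.isOpenInCone, ⟨y, hball (mem_ball_self hR)⟩,
      Function.update Φ y (cplxCoord A (a 0, 0)), fun z hz => ?_, ?_, fun z hz K hK => ?_⟩,
    fun x hx => Function.update_of_ne hx.2 _ _, Function.update_self _ _ _⟩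
  · obtain rfl | hzy := eq_or_ne z y
    · simp [← cplxCoord_conj]
    · have hzy' : star z ≠ y := fun hz => hzy (by simpa using congrArg star hz)
      rw [Function.update_of_ne hzy, Function.update_of_ne hzy', hΦ.map_star z ⟨hz, hzy⟩]
  · rw [ha]
    exact differentiableOn_update_circleCoeff hball hΦ.differentiableOn hρ hneg
  · obtain rfl | hzy := eq_or_ne z y
    · simp [evalAt]
    · rw [Function.update_of_ne hzy, Function.update_of_ne
        ((sliceEmb_eq_smul_one_iff hK).not.2 hzy), hΦ.induces z ⟨hz, hzy⟩ K hK]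

theorem order_eq_zero_and_apply_eq_of_extension {Ω' : Set A} (hg : SliceRegularOn g Ω')
    (hΩ : Ω \ {y • (1 : A)} ⊆ Ω') (hy : y • (1 : A) ∈ Ω') (hgf : EqOn g f (Ω \ {y • (1 : A)})) :
    order (Ω \ {y • (1 : A)}) f y = 0 ∧
      g (y • (1 : A)) = laurentCoeff (Ω \ {y • (1 : A)}) f y 0 := by
  obtain ⟨-, -, -, Φ, hΦ⟩ := (sliceRegularOn_iff hJ).1 hg
  obtain ⟨R, hR, hsub⟩ := h.isSingularity
  have hρ : R / 2 ∈ Ioo 0 R := ⟨half_pos hR, half_lt_self hR⟩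
  have hball : ball (y : ℂ) R ⊆ sliceEmb J ⁻¹' Ω' := fun z hz => by
    obtain rfl | hzy := eq_or_ne z y
    · simpa using hy
    · exact hΩ (ball_diff_subset_preimage hJ hnorm hsub ⟨hz, hzy⟩)
  have hΦf : IsHolomorphicStem (ball (y : ℂ) R \ {(y : ℂ)}) Φ f :=
    (hΦ.mono (sdiff_subset.trans hball)).congr fun z hz K hK =>
      hgf (hsub ((sliceEmb_mem_puncturedBall_iff hK hnorm).2 hz))
  have hΦR := hΦ.differentiableOn.mono hball
  refine ⟨order_eq_zero_iff.2 fun n hn => (hΦf.laurentCoeff_eq_zero_iff hJ hnorm hρ hsub n).2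
    (circleCoeff_eq_zero_of_neg hΦR hρ hn), ?_⟩
  rw [← sliceEmb_ofReal J, hΦ.induces y (hball (mem_ball_self hR)) J hJ,
    ← circleCoeff_zero hΦR hρ, ← hΦf.cplxCoord_laurentCoeff hJ hnorm hρ hsub]
  simp [evalAt]

theorem order_eq_zero_of_norm_le {U : Set A} (hU : U ∈ 𝓝[Ω] (y • (1 : A))) {M : ℝ}
    (hM : ∀ x ∈ U \ {y • (1 : A)}, ‖f x‖ ≤ M) : order (Ω \ {y • (1 : A)}) f y = 0 := by
  obtain ⟨Φ, R, hR, hΦ, hball, hsub⟩ := h.exists_stem hJ hnorm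
  obtain ⟨S, hS⟩ := exists_leftInverse_coordEval_prod (mul_self_of_mem_imagUnits hJ)
  obtain ⟨ε, hε, hεU⟩ := Metric.mem_nhdsWithin_iff.1 hU
  have hmin : ball (y : ℂ) (min ε R) \ {(y : ℂ)} ⊆ ball (y : ℂ) R \ {(y : ℂ)} :=
    sdiff_subset_sdiff_left (ball_subset_ball (min_le_right _ _))
  replace hΦ := hΦ.mono (hmin.trans (sdiff_subset_sdiff_left hball))
  have hsub' : puncturedBall y (min ε R) ⊆ Ω \ {y • (1 : A)} := fun x hx =>
    hsub ⟨hx.1, hx.2.1, hx.2.2.trans_le (min_le_right _ _)⟩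
  have hρ : min ε R / 2 ∈ Ioo 0 (min ε R) := ⟨half_pos (lt_min hε hR), half_lt_self (lt_min hε hR)⟩
  have hfM : ∀ z ∈ ball (y : ℂ) (min ε R) \ {(y : ℂ)}, ∀ K ∈ imagUnits A,
      ‖coordEval K (Φ z)‖ ≤ M := fun z hz K hK => by
    have hmem := (sliceEmb_mem_puncturedBall_iff hK hnorm).2 hz
    rw [← hΦ.induces z hz K hK]
    exact hM _ ⟨hεU ⟨mem_ball_iff_norm.2 (hmem.2.2.trans_le (min_le_left _ _)),
      (hsub' hmem).1⟩, (hsub' hmem).2⟩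
  have hbdd : BddAbove (norm ∘ Φ '' (ball (y : ℂ) (min ε R) \ {(y : ℂ)})) := by
    refine ⟨‖S‖ * M, forall_mem_image.2 fun z hz => ?_⟩
    rw [Function.comp_apply, ← hS (Φ z)]
    exact S.le_opNorm_of_le (norm_prod_le_iff.2
      ⟨hfM z hz J hJ, hfM z hz (-J) (neg_mem_imagUnits hJ)⟩)
  exact order_eq_zero_iff.2 fun n hn => (hΦ.laurentCoeff_eq_zero_iff hJ hnorm hρ hsub' n).2
    (circleCoeff_eq_zero_of_bddAbove hΦ.differentiableOn hbdd hρ hn)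

theorem order_eq_zero_iff_exists_norm_le :
    order (Ω \ {y • (1 : A)}) f y = 0 ↔
      ∃ U ∈ 𝓝[Ω] (y • (1 : A)), U ⊆ Ω ∧ ∃ M : ℝ, ∀ x ∈ U \ {y • (1 : A)}, ‖f x‖ ≤ M := by
  refine ⟨fun h0 => ?_, fun ⟨U, hU, _, M, hM⟩ => h.order_eq_zero_of_norm_le hJ hnorm hU hM⟩
  obtain ⟨g, hg, hgf, -⟩ := h.exists_extension_of_order_eq_zero hJ hnorm h0
  have hbound := (hg.continuousWithinAt hJ hnorm h.mem).norm.eventually_le_const (lt_add_one _)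
  refine ⟨_, inter_mem hbound self_mem_nhdsWithin, inter_subset_right,
    ‖g (y • (1 : A))‖ + 1, fun x hx => ?_⟩
  rw [← hgf ⟨hx.1.2, hx.2⟩]
  exact hx.1.1

theorem order_le_natCast_iff_exists_norm_pow_mul_le (k : ℕ) :
    order (Ω \ {y • (1 : A)}) f y ≤ k ↔
      ∃ U ∈ 𝓝[Ω] (y • (1 : A)), U ⊆ Ω ∧ ∃ M : ℝ,
        ∀ x ∈ U \ {y • (1 : A)}, ‖pow (x - y • (1 : A)) k * f x‖ ≤ M := by
  rw [← h.order_pow_mul_eq_zero_iff hJ hnorm,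
    (h.pow_mul hJ k).order_eq_zero_iff_exists_norm_le hJ hnorm]

theorem order_eq_natCast_iff_exists_extension {k : ℕ} (hk : k ≠ 0) :
    order (Ω \ {y • (1 : A)}) f y = k ↔ ∃ g, SliceRegularOn g Ω ∧
      (∀ x ∈ Ω \ {y • (1 : A)}, g x = pow (x - y • (1 : A)) k * f x) ∧ g (y • (1 : A)) ≠ 0 := by
  have hcoeff := h.laurentCoeff_pow_mul hJ hnorm k 0
  rw [zero_sub] at hcoeff
  rw [order_eq_natCast_iff hk, ← h.order_pow_mul_eq_zero_iff hJ hnorm, ← hcoeff]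
  constructor
  · rintro ⟨h0, hne⟩
    obtain ⟨g, hg, hgf, hgy⟩ := (h.pow_mul hJ k).exists_extension_of_order_eq_zero hJ hnorm h0
    exact ⟨g, hg, hgf, hgy ▸ hne⟩
  · rintro ⟨g, hg, hgf, hne⟩
    obtain ⟨h0, hgy⟩ := (h.pow_mul hJ k).order_eq_zero_and_apply_eq_of_extension hJ hnorm hg
      sdiff_subset h.mem hgf
    exact ⟨h0, hgy ▸ hne⟩

theorem isRemovableSingularity_iff_order_eq_zero :
    IsRemovableSingularity (Ω \ {y • (1 : A)}) f y ↔ order (Ω \ {y • (1 : A)}) f y = 0 := by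
  constructor
  · rintro ⟨-, Ω', g, hΩ, hy, hg, hgf⟩
    exact (h.order_eq_zero_and_apply_eq_of_extension hJ hnorm hg hΩ hy hgf).1
  · intro h0
    obtain ⟨g, hg, hgf, -⟩ := h.exists_extension_of_order_eq_zero hJ hnorm h0
    exact ⟨h.isSingularity, Ω, g, sdiff_subset, h.mem, hg, hgf⟩

theorem isPole_and_not_isRemovableSingularity_iff_order :
    (IsPole (Ω \ {y • (1 : A)}) f y ∧ ¬ IsRemovableSingularity (Ω \ {y • (1 : A)}) f y) ↔
      order (Ω \ {y • (1 : A)}) f y ≠ ⊤ ∧ 0 < order (Ω \ {y • (1 : A)}) f y := by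
  rw [isPole_iff, and_iff_right h.isSingularity,
    h.isRemovableSingularity_iff_order_eq_zero hJ hnorm, pos_iff_ne_zero]

theorem isPole_and_not_isRemovableSingularity_iff_exists_extension :
    (IsPole (Ω \ {y • (1 : A)}) f y ∧ ¬ IsRemovableSingularity (Ω \ {y • (1 : A)}) f y) ↔
      ∃ k : ℕ, k ≠ 0 ∧ ∃ g, SliceRegularOn g Ω ∧
        (∀ x ∈ Ω \ {y • (1 : A)}, g x = pow (x - y • (1 : A)) k * f x) ∧ g (y • (1 : A)) ≠ 0 := by
  rw [h.isPole_and_not_isRemovableSingularity_iff_order hJ hnorm]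
  constructor
  · rintro ⟨hfin, hpos⟩
    obtain ⟨k, hk⟩ := ENat.ne_top_iff_exists.1 hfin
    have hk0 : k ≠ 0 := fun hk0 => hpos.ne (by rw [← hk, hk0, Nat.cast_zero])
    exact ⟨k, hk0, (h.order_eq_natCast_iff_exists_extension hJ hnorm hk0).1 hk.symm⟩
  · rintro ⟨k, hk0, hg⟩
    rw [(h.order_eq_natCast_iff_exists_extension hJ hnorm hk0).2 hg]
    exact ⟨ENat.natCast_ne_top k, Nat.cast_pos.2 hk0.pos⟩

theorem tendsto_norm_atTop {k : ℕ} (hk : k ≠ 0) (horder : order (Ω \ {y • (1 : A)}) f y = k) :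
    Tendsto (fun x => ‖f x‖) (𝓝[Ω \ {y • (1 : A)}] (y • (1 : A))) atTop := by
  obtain ⟨g, hg, hgf, hgy⟩ := (h.order_eq_natCast_iff_exists_extension hJ hnorm hk).1 horder
  obtain ⟨C, hC, hmul⟩ := exists_norm_mul_le (A := A)
  have hnum : Tendsto (fun x => ‖g x‖) (𝓝[Ω \ {y • (1 : A)}] (y • (1 : A)))
      (𝓝 ‖g (y • (1 : A))‖) :=
    ((hg.continuousWithinAt hJ hnorm h.mem).mono sdiff_subset).norm
  have hpos : ∀ x ∈ Ω \ {y • (1 : A)}, 0 < C * ‖x - y • (1 : A)‖ ^ k := fun x hx =>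
    mul_pos hC (pow_pos (norm_pos_iff.2 (sub_ne_zero.2 hx.2)) k)
  have hden : Tendsto (fun x => C * ‖x - y • (1 : A)‖ ^ k)
      (𝓝[Ω \ {y • (1 : A)}] (y • (1 : A))) (𝓝[>] 0) := by
    refine tendsto_nhdsWithin_iff.2 ⟨?_, eventually_mem_nhdsWithin.mono hpos⟩
    have hcont : Continuous fun x : A => C * ‖x - y • (1 : A)‖ ^ k := by fun_prop
    exact (hcont.tendsto' _ _ (by simp [hk])).mono_left nhdsWithin_le_nhds
  refine tendsto_atTop_mono' _ (eventually_mem_nhdsWithin.mono fun x hx => ?_)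
    (hnum.pos_mul_atTop (norm_pos_iff.2 hgy) (tendsto_inv_nhdsGT_zero.comp hden))
  rw [Function.comp_apply, ← div_eq_mul_inv, div_le_iff₀' (hpos x hx),
    ← h.isCircular.norm_pow_sub hnorm hx.1, hgf x hx]
  exact hmul _ _

theorem isEssentialSingularity_iff_forall_exists_lt_norm :
    IsEssentialSingularity (Ω \ {y • (1 : A)}) f y ↔
      ∀ U ∈ 𝓝[Ω] (y • (1 : A)), U ⊆ Ω → ∀ k : ℕ, ∀ M : ℝ,
        ∃ x ∈ U \ {y • (1 : A)}, M < ‖pow (x - y • (1 : A)) k * f x‖ := by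
  rw [h.isEssentialSingularity_iff_order_eq_top, ENat.eq_top_iff_forall_gt]
  simp only [← not_le, h.order_le_natCast_iff_exists_norm_pow_mul_le hJ hnorm]
  push Not
  exact ⟨fun H U hU hUΩ k => H k U hU hUΩ, fun H k U hU hUΩ => H U hU hUΩ k⟩

end HasIsolatedSingularity

end IsolatedSingularity

end SliceRegular

theorem mainTheorem4 {A : Type*} [NormedAlternativeRing A] [Nontrivial A] [StarRing A]
    [NormedSpace ℝ A] [IsScalarTower ℝ A A] [SMulCommClass ℝ A A] [StarModule ℝ A]
    [FiniteDimensional ℝ A]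
    (hS : (SliceRegular.imagUnits A).Nonempty)
    (hnorm : ∀ x ∈ SliceRegular.quadraticCone A, (‖x‖ ^ 2) • (1 : A) = x * star x)
    (Ωt : Set A) (hcirc : SliceRegular.IsCircular Ωt) (hopen : SliceRegular.IsOpenInCone Ωt)
    (y : ℝ) (hy : y • (1 : A) ∈ Ωt)
    (Ω : Set A) (hΩ : Ω = Ωt \ {y • (1 : A)})
    (f : A → A) (hf : SliceRegular.SliceRegularOn f Ω) :
    -- `y` is a singularity, and the order refers to a Laurent expansion that exists and is unique
    (SliceRegular.IsSingularity Ω y ∧ ∃! a : ℤ → A, SliceRegular.HasLaurentExpansion Ω f y a) ∧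
    -- the trichotomy
    (SliceRegular.IsRemovableSingularity Ω f y ∨
      (SliceRegular.IsPole Ω f y ∧ ¬ SliceRegular.IsRemovableSingularity Ω f y) ∨
      SliceRegular.IsEssentialSingularity Ω f y) ∧
    -- 1a, 1b
    (SliceRegular.IsRemovableSingularity Ω f y ↔ SliceRegular.order Ω f y = 0) ∧
    (SliceRegular.IsRemovableSingularity Ω f y ↔
      ∃ U ∈ 𝓝[Ωt] (y • (1 : A)), U ⊆ Ωt ∧ ∃ M : ℝ, ∀ x ∈ U \ {y • (1 : A)}, ‖f x‖ ≤ M) ∧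
    -- 2a, 2b
    ((SliceRegular.IsPole Ω f y ∧ ¬ SliceRegular.IsRemovableSingularity Ω f y) ↔
      (SliceRegular.order Ω f y ≠ ⊤ ∧ 0 < SliceRegular.order Ω f y)) ∧
    ((SliceRegular.IsPole Ω f y ∧ ¬ SliceRegular.IsRemovableSingularity Ω f y) ↔
      ∃ k : ℕ, k ≠ 0 ∧ ∃ g : A → A, SliceRegular.SliceRegularOn g Ωt ∧
        (∀ x ∈ Ω, g x = SliceRegular.pow (x - y • (1 : A)) k * f x) ∧ g (y • (1 : A)) ≠ 0) ∧
    -- the supplement to 2b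
    (∀ k : ℕ, k ≠ 0 → ∀ g : A → A, SliceRegular.SliceRegularOn g Ωt →
      (∀ x ∈ Ω, g x = SliceRegular.pow (x - y • (1 : A)) k * f x) → g (y • (1 : A)) ≠ 0 →
        SliceRegular.order Ω f y = (k : ℕ∞) ∧
        Tendsto (fun x => ‖f x‖) (𝓝[Ω] (y • (1 : A))) atTop) ∧
    -- 3a, 3b
    (SliceRegular.IsEssentialSingularity Ω f y ↔ SliceRegular.order Ω f y = ⊤) ∧
    (SliceRegular.IsEssentialSingularity Ω f y ↔
      ∀ U ∈ 𝓝[Ωt] (y • (1 : A)), U ⊆ Ωt → ∀ k : ℕ, ∀ M : ℝ,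
        ∃ x ∈ U \ {y • (1 : A)}, M < ‖SliceRegular.pow (x - y • (1 : A)) k * f x‖) := by
  subst hΩ
  obtain ⟨J, hJ⟩ := hS
  have h : SliceRegular.HasIsolatedSingularity Ωt f y := ⟨hcirc, hopen, hy, hf⟩
  have hremovable := h.isRemovableSingularity_iff_order_eq_zero hJ hnorm
  refine ⟨⟨h.isSingularity, h.existsUnique_hasLaurentExpansion hJ hnorm⟩, ?_, hremovable,
    hremovable.trans (h.order_eq_zero_iff_exists_norm_le hJ hnorm),
    h.isPole_and_not_isRemovableSingularity_iff_order hJ hnorm,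
    h.isPole_and_not_isRemovableSingularity_iff_exists_extension hJ hnorm,
    fun k hk g hg hgf hgy => ?_, h.isEssentialSingularity_iff_order_eq_top,
    h.isEssentialSingularity_iff_forall_exists_lt_norm hJ hnorm⟩
  · have hessential : SliceRegular.IsEssentialSingularity _ f y ↔ ¬ SliceRegular.IsPole _ f y :=
      and_iff_right h.isSingularity
    tauto
  · have horder := (h.order_eq_natCast_iff_exists_extension hJ hnorm hk).2 ⟨g, hg, hgf, hgy⟩
    exact ⟨horder, h.tendsto_norm_atTop hJ hnorm hk horder⟩
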